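/- **Setting.** Let $n,S,A,H\in\mathbb N$ with $4\mid S$, $S\ge 8$, $A\ge S/2$, $H\ge 2$. Put $\mathcal S_0=\{1,\dots,S/2\}$, $\mathcal S_1=\{S/2+1,\dots,S\}$, let $\iota(s)=i$ for $s\in\mathcal S_i$, and let $n_0=\lfloor n/2\rfloor$, $n_1=n-n_0$. *Decoding functions.* Let $\mathfrak s_i^{\sigma}$ ($i\in\{0,1\}$, $\sigma\in\{-1,0,1\}$) be any nonnegative integers with $\mathfrak s_i^{+1}\ge S/36$, $\mathfrak s_i^0>0$, $\sum_\sigma \mathfrak s_i^\sigma=S/2$ and $\sum_\sigma\mathfrak s_i^\sigma(\lfloor n_i/(S/2)\rfloor+\sigma)=n_i$. Let $\mathcal F$ be the set of all $f:[n]\to[S]$ such that $f^{-1}(\mathcal S_0)=\{1,\dots,\lfloor n/2\rfloor\}$ and, for $i\in\{0,1\}$, every $s\in\mathcal S_i$ satisfies $|f^{-1}(s)|=\lfloor n_i/(S/2)\rfloor+\sigma$ for some $\sigma\in\{-1,0,1\}$, each value $\sigma$ occurring for exactly $\mathfrak s_i^\sigma$ states $s\in\mathcal S_i$. *Processes.*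 Let $\varepsilon=(\varepsilon_0,\varepsilon_1)$, let $a^*=(a^*_s)_{s\in[S]}\in[A]^S$ have $a^*_{s}\ne a^*_{s'}$ for distinct $s,s'\in\mathcal S_1$, and for every $s\in[S]$ let $\tilde p_0(\cdot\mid s)$, $\tilde p_1(\cdot\mid s)$ be probability distributions on $\mathcal S_0$, $\mathcal S_1$. The block Markov decision process $\Phi(\varepsilon,\tilde p,f,a^*)$ has contexts $[n]$, latent states $[S]$, actions $[A]$, decoding function $f$, initial context distribution uniform on $[n]$, rewards $r_h(x,a)=\mathbf 1\{f(x)\in\mathcal S_1\}$, and transition probabilities $P(y\mid x,a)=p(f(y)\mid f(x),a)\,q(y\mid f(y))$, where $q(y\mid s)=1/|f^{-1}(s)|$ for $y\in f^{-1}(s)$ and $$p(s'\mid s,a)=\begin{cases}\tfrac12\tilde p_{\iota(s')}(s'\mid s), & a\ne a^*_s,\\ \tfrac12(1-2\varepsilon_{\iota(s)})\,\tilde p_0(s'\mid s), & a=a_s^*,\ s'\in\mathcal S_0,\\ \tfrac12(1+2\varepsilon_{\iota(s)})\,\tilde p_1(s'\mid s), & a=a_s^*,\ s'\in\mathcal S_1.\end{cases}$$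 *Algorithms.* An episode is a sequence $(x_1,a_1,\dots,x_H,a_H,x_{H+1})$. A learning algorithm $\mathcal L$ chooses the (randomized, memoryless) policy of episode $k$ as a function of the record $\mathcal D_k$ of the first $k-1$ episodes and of the reward function; a latent-state estimation algorithm $\mathcal C$ outputs a function $\hat f_{\mathcal C,k}:[n]\to[S]$ of the same data. $\mathbb E_f$ denotes expectation when $\mathcal L$ interacts with $\Phi(\varepsilon,\tilde p,f,a^*)$, and $T_k=kH$. *Misclassifications.* For $\hat f,f:[n]\to[S]$ let $$|\mathcal E(\hat f;f,\mathcal S_1)|=\min_{\gamma\in\mathrm{Perm}([S])}\bigl|\{x\in f^{-1}(\mathcal S_1):\hat f(x)\ne\gamma(f(x))\}\bigr| .$$ **Proposition.** For every $\eta>1$ there is a constant $C>0$, depending only on $\eta$, such that the following holds. Let $S=S(n)$ with $S(n)=o(n)$, $4\mid S(n)$ and $S(n)\ge 8$. Then for all sufficiently large $n$, all $A\ge S/2$, $H\ge2$, all $\mathfrak s_i^\sigma$ as above, all $\varepsilon_0,\varepsilon_1$ with $0\le\varepsilon_i<\frac12\frac{\eta-1}{\eta+1}$, all $\tilde p$ as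 above with $$|\tilde p_{\iota(s')}(s'\mid s)-2/S|\le \frac{2\kappa}{S}\quad(s,s'\in[S]),\qquad \kappa=\frac{\eta(1-2\epsilon_{\max})-(1+2\epsilon_{\max})}{\eta(1-2\epsilon_{\max})+(1+2\epsilon_{\max})},\quad \epsilon_{\max}=\max(\varepsilon_0,\varepsilon_1),$$ all $a^*$ as above, every learning algorithm $\mathcal L$, every latent-state estimation algorithm $\mathcal C$ and every $k\ge1$, $$\frac1{|\mathcal F|}\sum_{f\in\mathcal F}\mathbb E_f\bigl[|\mathcal E(\hat f_{\mathcal C,k};f,\mathcal S_1)|\bigr]\ \ge\ \frac n{144}\exp\Bigl(-C\,\frac{T_k}{n}\Bigr).$$ -/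

import Mathlib

open Filter Asymptotics Finset

noncomputable section

/-- A reward function `r_h(x, a) ∈ [0, 1]` on `n` contexts, `A` actions, horizon `H`. -/
abbrev Reward (n A H : ℕ) : Type := Fin H → Fin n → Fin A → unitInterval

/-- The tuple `(f, p, q, μ, r)` describing a block Markov decision process:
`p s a s'` is `p(s' ∣ s, a)` and `q s x` is `q(x ∣ s)`.
The requirements on such a tuple are collected in `BMDP.IsValid`. -/
structure BMDP (n S A H : ℕ) where
  f : Fin n → Fin S
  p : Fin S → Fin A → Fin S → ℝ
  q : Fin S → Fin n → ℝ
  μ : Fin n → ℝ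
  r : Reward n A H

/-- The kernels and the initial law are probability distributions, and contexts are emitted
only from the latent state to which they belong. -/
structure BMDP.IsValid {n S A H : ℕ} (Φ : BMDP n S A H) : Prop where
  p_nonneg : ∀ s a s', 0 ≤ Φ.p s a s'
  p_sum : ∀ s a, ∑ s', Φ.p s a s' = 1
  q_nonneg : ∀ s x, 0 ≤ Φ.q s x
  q_sum : ∀ s, ∑ x, Φ.q s x = 1
  q_supp : ∀ s x, Φ.f x ≠ s → Φ.q s x = 0
  μ_nonneg : ∀ x, 0 ≤ Φ.μ x
  μ_sum : ∑ x, Φ.μ x = 1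

/-- `Φ.trans x a y` is `P(y ∣ x, a) = p(f(y) ∣ f(x), a) q(y ∣ f(y))`. -/
def BMDP.trans {n S A H : ℕ} (Φ : BMDP n S A H) (x : Fin n) (a : Fin A) (y : Fin n) : ℝ :=
  Φ.p (Φ.f x) a (Φ.f y) * Φ.q (Φ.f y) y

/-- A memoryless (randomised) policy; `prob h x a` is `π_h(a ∣ x)`. -/
structure Policy (n A H : ℕ) where
  prob : Fin H → Fin n → Fin A → ℝ
  nonneg : ∀ h x a, 0 ≤ prob h x a
  sum_one : ∀ h x, ∑ a, prob h x a = 1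

/-- The record `(x_1, a_1, …, x_H, a_H, x_{H+1})` of one episode, in `([n] × [A])^H × [n]`. -/
abbrev Episode (n A H : ℕ) : Type := (Fin H → Fin n × Fin A) × Fin n

/-- The contexts `x_1, …, x_{H+1}` of an episode. -/
def Episode.ctx {n A H : ℕ} (τ : Episode n A H) : Fin (H + 1) → Fin n :=
  Fin.snoc (α := fun _ => Fin n) (fun h => (τ.1 h).1) τ.2

/-- The probability of an episode under the process `Φ` and the policy `π`. -/
def episodeProb {n S A H : ℕ} (Φ : BMDP n S A H) (π : Policy n A H) (τ : Episode n A H) : ℝ :=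
  Φ.μ (τ.ctx 0) *
    ∏ h : Fin H, (π.prob h (τ.1 h).1 (τ.1 h).2 *
      Φ.trans (τ.1 h).1 (τ.1 h).2 (τ.ctx h.succ))

/-- An episodic learning algorithm: from the records of the `j` past episodes and the reward
function it chooses the policy of the next episode, number `j + 1`. -/
abbrev LearningAlgorithm (n A H : ℕ) : Type :=
  (j : ℕ) → (Fin j → Episode n A H) → Reward n A H → Policy n A H

/-- A latent-state estimation algorithm: from the records of `j` episodes and the reward function
it produces an estimated decoding function. -/
abbrev EstimationAlgorithm (n S A H : ℕ) : Type :=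
  (j : ℕ) → (Fin j → Episode n A H) → Reward n A H → (Fin n → Fin S)

/-- The probability that the first `j` episodes are `D`, when the policies are chosen by `L`. -/
def historyProb {n S A H : ℕ} (Φ : BMDP n S A H) (L : LearningAlgorithm n A H) (j : ℕ)
    (D : Fin j → Episode n A H) : ℝ :=
  ∏ i : Fin j,
    episodeProb Φ (L (i : ℕ) (fun l : Fin (i : ℕ) => D (Fin.castLE i.isLt.le l)) Φ.r) (D i)

/-- The expectation of a function of the first `j` episodes. -/
def historyExp {n S A H : ℕ} (Φ : BMDP n S A H) (L : LearningAlgorithm n A H) (j : ℕ)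
    (X : (Fin j → Episode n A H) → ℝ) : ℝ :=
  ∑ D : Fin j → Episode n A H, historyProb Φ L j D * X D

/-- The number of contexts in the latent states `T` that `fhat` misclassifies, up to relabelling
of the latent states: the minimum over permutations `γ` of the latent states of the number of
contexts `x ∈ f⁻¹(T)` with `fhat x ≠ γ (f x)`. -/
def misclassCount {n S : ℕ} (fhat f : Fin n → Fin S) (T : Finset (Fin S)) : ℕ :=
  (Finset.univ : Finset (Equiv.Perm (Fin S))).inf' ⟨1, Finset.mem_univ 1⟩
    (fun γ => #{x : Fin n | f x ∈ T ∧ fhat x ≠ γ (f x)})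

/-- `iota s = 0` on the first `S / 2` latent states, `iota s = 1` on the others. -/
def iota {S : ℕ} (s : Fin S) : Fin 2 := if (s : ℕ) < S / 2 then 0 else 1

/-- The half `𝒮_i` of the latent states. -/
def half (S : ℕ) (i : Fin 2) : Finset (Fin S) := {s | iota s = i}

/-- The fibre `f⁻¹(s)`. -/
def fiber {n S : ℕ} (f : Fin n → Fin S) (s : Fin S) : Finset (Fin n) := {x | f x = s}

/-- The candidate hard-to-learn process `Φ(ε, p̃, f, a⋆)`. The pair `p̃ = (p̃_0, p̃_1)` is encoded as
one function, `pt s s' = p̃_{ι(s')}(s' ∣ s)`. -/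
def hardBMDP {n S A : ℕ} (H : ℕ) (ε : Fin 2 → ℝ) (pt : Fin S → Fin S → ℝ) (f : Fin n → Fin S)
    (astar : Fin S → Fin A) : BMDP n S A H where
  f := f
  p := fun s a s' =>
    if a ≠ astar s then 1 / 2 * pt s s'
    else if iota s' = 0 then 1 / 2 * (1 - 2 * ε (iota s)) * pt s s'
    else 1 / 2 * (1 + 2 * ε (iota s)) * pt s s'
  q := fun s x => if f x = s then 1 / (#(fiber f s) : ℝ) else 0
  μ := fun _ => 1 / (n : ℝ)
  r := fun _ x _ => if iota (f x) = 1 then 1 else 0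

/-- `p̃_0(· ∣ s)` and `p̃_1(· ∣ s)` are probability distributions on `𝒮_0` and `𝒮_1`. -/
structure IsKernelPair {S : ℕ} (pt : Fin S → Fin S → ℝ) : Prop where
  nonneg : ∀ s s', 0 ≤ pt s s'
  sum_one : ∀ s i, ∑ s' ∈ half S i, pt s s' = 1

/-- The radius `κ` around the uniform distribution. -/
def kappa (η : ℝ) (ε : Fin 2 → ℝ) : ℝ :=
  (η * (1 - 2 * max (ε 0) (ε 1)) - (1 + 2 * max (ε 0) (ε 1))) /
    (η * (1 - 2 * max (ε 0) (ε 1)) + (1 + 2 * max (ε 0) (ε 1)))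

/-- The numbers of contexts `n_0 = ⌊n/2⌋` and `n_1 = n - n_0` in the two halves. -/
def halfContexts (n : ℕ) (i : Fin 2) : ℕ := if i = 0 then n / 2 else n - n / 2

/-- Admissible numbers `sz i σ`, for `σ ∈ {-1, 0, 1}`, of latent states in `𝒮_i` with
`⌊n_i / (S/2)⌋ + σ` contexts. -/
structure IsSizeProfile (n S : ℕ) (sz : Fin 2 → SignType → ℕ) : Prop where
  plus : ∀ i, (S : ℝ) / 36 ≤ sz i 1
  zero : ∀ i, 0 < sz i 0
  total : ∀ i, ∑ σ, sz i σ = S / 2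
  contexts : ∀ i, ∑ σ : SignType,
    (sz i σ : ℤ) * (((halfContexts n i / (S / 2) : ℕ) : ℤ) + (σ : ℤ)) = halfContexts n i

/-- `𝒮_i^σ(f)`: the latent states of `𝒮_i` with exactly `⌊|f⁻¹(𝒮_i)| / |𝒮_i|⌋ + σ` contexts. -/
def sizeClass {n S : ℕ} (f : Fin n → Fin S) (i : Fin 2) (σ : SignType) : Finset (Fin S) :=
  {s ∈ half S i | (#(fiber f s) : ℤ) =
    ((#{x : Fin n | f x ∈ half S i} / #(half S i) : ℕ) : ℤ) + (σ : ℤ)}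

open Classical in
/-- The set `ℱ` of decoding functions of the hard-to-learn class. -/
def decodingClass (n S : ℕ) (sz : Fin 2 → SignType → ℕ) : Finset (Fin n → Fin S) :=
  {f | (∀ x : Fin n, f x ∈ half S 0 ↔ (x : ℕ) < n / 2) ∧
    (∀ i, ∀ s ∈ half S i, ∃ σ, s ∈ sizeClass f i σ) ∧
    (∀ i σ, #(sizeClass f i σ) = sz i σ)}

theorem hardBMDP_isValid {n S A : ℕ} (H : ℕ) (hn : 0 < n) {ε : Fin 2 → ℝ}
    (hε : ∀ i, 0 ≤ ε i ∧ ε i ≤ 1 / 2) {pt : Fin S → Fin S → ℝ} (hpt : IsKernelPair pt)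
    {f : Fin n → Fin S} (hf : Function.Surjective f) (astar : Fin S → Fin A) :
    (hardBMDP H ε pt f astar).IsValid := by
  have h01 : ∀ s' : Fin S, iota s' = 0 ∨ iota s' = 1 := fun s' => by
    unfold iota; split_ifs <;> simp
  have hsplit : ∀ g : Fin S → ℝ, ∑ s', g s' = ∑ s' ∈ half S 0, g s' + ∑ s' ∈ half S 1, g s' := by
    intro g
    rw [← Finset.sum_filter_add_sum_filter_not Finset.univ (fun s' : Fin S => iota s' = 0)]
    congr 1
    refine Finset.sum_congr ?_ fun _ _ => rfl
    ext s'
    rcases h01 s' with h | h <;> simp [half, h]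
  constructor
  · intro s a s'
    have h1 := hε (iota s)
    have h2 := hpt.nonneg s s'
    simp only [hardBMDP]
    split_ifs
    · positivity
    · exact mul_nonneg (by linarith [h1.2]) h2
    · exact mul_nonneg (by linarith [h1.1]) h2
  · intro s a
    rw [hsplit]
    have e0 := hpt.sum_one s 0
    have e1 := hpt.sum_one s 1
    by_cases ha : a = astar s
    · have g0 : ∀ s' ∈ half S 0, (hardBMDP H ε pt f astar).p s a s' =
          1 / 2 * (1 - 2 * ε (iota s)) * pt s s' := by
        intro s' hs'
        have : iota s' = 0 := by simpa [half] using hs'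
        simp [hardBMDP, ha, this]
      have g1 : ∀ s' ∈ half S 1, (hardBMDP H ε pt f astar).p s a s' =
          1 / 2 * (1 + 2 * ε (iota s)) * pt s s' := by
        intro s' hs'
        have : iota s' = 1 := by simpa [half] using hs'
        simp [hardBMDP, ha, this]
      rw [Finset.sum_congr rfl g0, Finset.sum_congr rfl g1, ← Finset.mul_sum, ← Finset.mul_sum,
        e0, e1]
      ring
    · have g : ∀ s', (hardBMDP H ε pt f astar).p s a s' = 1 / 2 * pt s s' := by
        intro s'
        simp [hardBMDP, ha]
      simp only [g]
      rw [← Finset.mul_sum, ← Finset.mul_sum, e0, e1]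
      ring
  · intro s x
    simp only [hardBMDP]
    split_ifs <;> positivity
  · intro s
    obtain ⟨x, hx⟩ := hf s
    have hne : (#(fiber f s) : ℝ) ≠ 0 := by
      have : x ∈ fiber f s := by simp [fiber, hx]
      exact_mod_cast (Finset.card_pos.mpr ⟨x, this⟩).ne'
    simp only [hardBMDP]
    rw [← Finset.sum_filter, Finset.sum_const, nsmul_eq_mul]
    exact mul_one_div_cancel hne
  · intro s x hx
    simp only [hardBMDP] at hx ⊢
    simp [hx]
  · intro x
    simp only [hardBMDP]
    positivity
  · simp only [hardBMDP, Finset.sum_const, Finset.card_univ, Fintype.card_fin, nsmul_eq_mul]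
    exact mul_one_div_cancel (by positivity)

end

/-!
The bound follows from a local exchange argument. Fix two contexts `x`, `x'` whose latent states lie
in `𝒮_1` and differ under `f`, and exchange their labels: `f ∘ swap x x'` has the same fibre
cardinalities, hence lies in `ℱ` again, and as long as neither `x` nor `x'` has been observed the
record has exactly the same probability under `f` and under `f ∘ swap x x'`
(`historyProb_hardBMDP_comp_perm`). The rewards do not distinguish the two functions either, so
conditionally on such a record any estimate faces both with equal weight.

The minimum over relabellings is handled by charging to a pair `(x, x')` not only the
misclassification of `x`, but also the fractions of misclassified contexts in the two latent states
concerned. If the optimal relabellings before and after the exchange agree on these two states, `x`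
is misclassified on at least one side. If they differ on a state, every context of this state other
than the exchanged one is misclassified on at least one side. In both cases the total charge is at
least `1` (`one_le_pairCharge_add`), while the charges of all pairs sum to `5 |X|` times the
number of misclassified contexts, `X` being the set of contexts of `𝒮_1` (`sum_pairCharge`). Since
at least half of the pairs in `X × X` have different latent states, the average number of
misclassifications is at least `n / 40` times the smallest probability that a pair remains
unobserved.

Finally, in every step each context is reached with probability at most `8 / n`, because latent
transition probabilities are at most `4 / S` and fibres have at least `n / (2 S)` elements. The
process killed on `{x, x'}` thus retains at least the fraction `1 - 16 / n` of its mass per step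
(`pow_le_sum_historyProb_killed`), which yields the factor `exp (-64 k H / n)`.
-/

/-! ### Sub-Markov lower bounds for episodes and histories -/

theorem Episode.ctx_snoc_castSucc {n A H : ℕ} (τ : Episode n A H) (a : Fin A) (y : Fin n)
    (h : Fin (H + 1)) :
    Episode.ctx (H := H + 1) (Fin.snoc (α := fun _ => Fin n × Fin A) τ.1 (τ.2, a), y) h.castSucc =
      τ.ctx h := by
  simp only [Episode.ctx, Fin.snoc_castSucc]
  induction h using Fin.lastCases <;> simp

theorem Episode.ctx_snoc_last {n A H : ℕ} (v : Fin H → Fin n × Fin A) (y : Fin n) :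
    Episode.ctx (v, y) (Fin.last H) = y := by
  simp [Episode.ctx]

/-- If the initial law and every transition law retain mass at least `b`, then the law of the whole
episode retains mass at least `b ^ (H + 1)`. -/
theorem pow_le_sum_path {n A : ℕ} {μ : Fin n → ℝ} {K : Fin n → Fin A → Fin n → ℝ} {b : ℝ}
    (hb : 0 ≤ b) (hμ : ∀ x, 0 ≤ μ x) (hK : ∀ x a y, 0 ≤ K x a y) (hμb : b ≤ ∑ x, μ x)
    (hKb : ∀ x a, b ≤ ∑ y, K x a y) (H : ℕ) (π : Fin H → Fin n → Fin A → ℝ)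
    (hπ : ∀ h x a, 0 ≤ π h x a) (hπ1 : ∀ h x, ∑ a, π h x a = 1) :
    b ^ (H + 1) ≤ ∑ τ : Episode n A H, μ (τ.ctx 0) *
      ∏ h : Fin H, (π h (τ.1 h).1 (τ.1 h).2 * K (τ.1 h).1 (τ.1 h).2 (τ.ctx h.succ)) := by
  induction H with
  | zero =>
    rw [Fintype.sum_prod_type]
    simpa [Episode.ctx, Fin.snoc] using hμb
  | succ H ih =>
    have key := ih (fun h => π h.castSucc) (fun h => hπ _) (fun h => hπ1 _)
    let w : Episode n A H → ℝ := fun τ => μ (τ.ctx 0) *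
      ∏ h : Fin H, (π h.castSucc (τ.1 h).1 (τ.1 h).2 * K (τ.1 h).1 (τ.1 h).2 (τ.ctx h.succ))
    have hw : ∀ τ, 0 ≤ w τ := fun τ =>
      mul_nonneg (hμ _) (prod_nonneg fun h _ => mul_nonneg (hπ _ _ _) (hK _ _ _))
    have hlast : ∀ x, b ≤ ∑ a, ∑ y, π (Fin.last H) x a * K x a y := by
      intro x
      calc b = ∑ a, π (Fin.last H) x a * b := by rw [← sum_mul, hπ1, one_mul]
        _ ≤ _ := by
          refine sum_le_sum fun a _ => ?_
          rw [← mul_sum]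
          exact mul_le_mul_of_nonneg_left (hKb x a) (hπ _ _ _)
    calc b ^ (H + 1 + 1) = b ^ (H + 1) * b := pow_succ _ _
      _ ≤ (∑ τ, w τ) * b := mul_le_mul_of_nonneg_right key hb
      _ = ∑ τ, w τ * b := sum_mul _ _ _
      _ ≤ ∑ τ, w τ * ∑ a, ∑ y, π (Fin.last H) τ.2 a * K τ.2 a y :=
          sum_le_sum fun τ _ => mul_le_mul_of_nonneg_left (hlast _) (hw τ)
      _ = _ := by
        rw [Fintype.sum_prod_type, Fintype.sum_prod_type,
          ← (Fin.snocEquiv (fun _ => Fin n × Fin A)).sum_comp, Fintype.sum_prod_type,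
          Fintype.sum_prod_type, sum_comm]
        refine sum_congr rfl fun x _ => ?_
        simp_rw [mul_sum]
        rw [sum_comm]
        refine sum_congr rfl fun a _ => sum_congr rfl fun v _ => sum_congr rfl fun y _ => ?_
        have h0 : Episode.ctx (Fin.snocEquiv (fun _ => Fin n × Fin A) ((x, a), v), y) 0 =
            Episode.ctx (v, x) 0 := Episode.ctx_snoc_castSucc (v, x) a y 0
        have h1 : ∀ h : Fin H,
            Episode.ctx (Fin.snocEquiv (fun _ => Fin n × Fin A) ((x, a), v), y) h.castSucc.succ =
              Episode.ctx (v, x) h.succ := fun h => Episode.ctx_snoc_castSucc (v, x) a y h.succ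
        rw [Fin.prod_univ_castSucc, h0, Fin.succ_last, Episode.ctx_snoc_last]
        simp only [h1, Fin.snocEquiv_apply, Fin.snoc_castSucc, Fin.snoc_last, w]
        ring

theorem pow_le_sum_episodeProb {n S A H : ℕ} {Φ : BMDP n S A H} {b : ℝ} (hb : 0 ≤ b)
    (hμ : ∀ x, 0 ≤ Φ.μ x) (hK : ∀ x a y, 0 ≤ Φ.trans x a y) (hμb : b ≤ ∑ x, Φ.μ x)
    (hKb : ∀ x a, b ≤ ∑ y, Φ.trans x a y) (π : Policy n A H) :
    b ^ (H + 1) ≤ ∑ τ, episodeProb Φ π τ :=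
  pow_le_sum_path hb hμ hK hμb hKb H π.prob π.nonneg π.sum_one

theorem episodeProb_nonneg {n S A H : ℕ} {Φ : BMDP n S A H} (hμ : ∀ x, 0 ≤ Φ.μ x)
    (hK : ∀ x a y, 0 ≤ Φ.trans x a y) (π : Policy n A H) (τ : Episode n A H) :
    0 ≤ episodeProb Φ π τ :=
  mul_nonneg (hμ _) (prod_nonneg fun _ _ => mul_nonneg (π.nonneg _ _ _) (hK _ _ _))

theorem historyProb_nonneg {n S A H : ℕ} {Φ : BMDP n S A H} (hμ : ∀ x, 0 ≤ Φ.μ x)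
    (hK : ∀ x a y, 0 ≤ Φ.trans x a y) (L : LearningAlgorithm n A H) (j : ℕ)
    (D : Fin j → Episode n A H) : 0 ≤ historyProb Φ L j D :=
  prod_nonneg fun _ _ => episodeProb_nonneg hμ hK _ _

theorem historyProb_snoc {n S A H : ℕ} (Φ : BMDP n S A H) (L : LearningAlgorithm n A H) (j : ℕ)
    (D : Fin j → Episode n A H) (τ : Episode n A H) :
    historyProb Φ L (j + 1) (Fin.snoc (α := fun _ => Episode n A H) D τ) =
      historyProb Φ L j D * episodeProb Φ (L j D Φ.r) τ := by
  have hpre : ∀ (i : ℕ) (hi : i ≤ j),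
      (fun l : Fin i => Fin.snoc (α := fun _ => Episode n A H) D τ
        (Fin.castLE (hi.trans j.le_succ) l)) = fun l => D (Fin.castLE hi l) := fun i hi => by
    funext l
    exact Fin.snoc_castSucc (α := fun _ => Episode n A H) τ D (Fin.castLE hi l)
  unfold historyProb
  rw [Fin.prod_univ_castSucc]
  congr 1
  · refine prod_congr rfl fun i _ => ?_
    rw [Fin.snoc_castSucc]
    exact congrArg (fun d => episodeProb Φ (L i d Φ.r) (D i)) (hpre i i.isLt.le)
  · rw [Fin.snoc_last]
    exact congrArg (fun d => episodeProb Φ (L j d Φ.r) τ) (hpre j le_rfl)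

/-- No normalisation is assumed, so that the bound applies to the killed processes below. -/
theorem pow_le_sum_historyProb {n S A H : ℕ} {Φ : BMDP n S A H} {b : ℝ} (hb : 0 ≤ b)
    (hμ : ∀ x, 0 ≤ Φ.μ x) (hK : ∀ x a y, 0 ≤ Φ.trans x a y) (hμb : b ≤ ∑ x, Φ.μ x)
    (hKb : ∀ x a, b ≤ ∑ y, Φ.trans x a y) (L : LearningAlgorithm n A H) (j : ℕ) :
    (b ^ (H + 1)) ^ j ≤ ∑ D, historyProb Φ L j D := by
  induction j with
  | zero => simp [historyProb]
  | succ j ih =>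
    calc (b ^ (H + 1)) ^ (j + 1) = (b ^ (H + 1)) ^ j * b ^ (H + 1) := pow_succ _ _
      _ ≤ (∑ D, historyProb Φ L j D) * b ^ (H + 1) := by gcongr
      _ = ∑ D, historyProb Φ L j D * b ^ (H + 1) := sum_mul _ _ _
      _ ≤ ∑ D, historyProb Φ L j D * ∑ τ, episodeProb Φ (L j D Φ.r) τ :=
          sum_le_sum fun D _ => mul_le_mul_of_nonneg_left
            (pow_le_sum_episodeProb hb hμ hK hμb hKb _) (historyProb_nonneg hμ hK L j D)
      _ = _ := by
        rw [← (Fin.snocEquiv (fun _ => Episode n A H)).sum_comp, Fintype.sum_prod_type, sum_comm]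
        refine sum_congr rfl fun D _ => ?_
        rw [mul_sum]
        exact sum_congr rfl fun τ _ => (historyProb_snoc Φ L j D τ).symm

/-! ### The process killed on a set of contexts -/

/-- The (defective) process obtained from `Φ` by removing the mass of every arrival in `Z`. -/
def BMDP.killed {n S A H : ℕ} (Φ : BMDP n S A H) (Z : Finset (Fin n)) : BMDP n S A H where
  f := Φ.f
  p := Φ.p
  q := fun s x => if x ∈ Z then 0 else Φ.q s x
  μ := fun x => if x ∈ Z then 0 else Φ.μ x
  r := Φ.r

/-- The record `D` contains no context of `Z`. -/
def Avoids {n A H j : ℕ} (Z : Finset (Fin n)) (D : Fin j → Episode n A H) : Prop :=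
  ∀ i h, (D i).ctx h ∉ Z

theorem killed_trans {n S A H : ℕ} (Φ : BMDP n S A H) (Z : Finset (Fin n)) (x : Fin n) (a : Fin A)
    (y : Fin n) : (Φ.killed Z).trans x a y = if y ∈ Z then 0 else Φ.trans x a y := by
  simp only [BMDP.trans, BMDP.killed]
  split_ifs <;> simp

theorem historyProb_killed_of_avoids {n S A H : ℕ} (Φ : BMDP n S A H) {Z : Finset (Fin n)}
    (L : LearningAlgorithm n A H) {j : ℕ} {D : Fin j → Episode n A H} (hD : Avoids Z D) :
    historyProb (Φ.killed Z) L j D = historyProb Φ L j D := by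
  refine prod_congr rfl fun i _ => ?_
  simp only [episodeProb, killed_trans]
  congr 1
  · exact if_neg (hD i 0)
  · exact prod_congr rfl fun h _ => by rw [if_neg (hD i h.succ)]; rfl

theorem historyProb_killed_of_not_avoids {n S A H : ℕ} (Φ : BMDP n S A H) {Z : Finset (Fin n)}
    (L : LearningAlgorithm n A H) {j : ℕ} {D : Fin j → Episode n A H} (hD : ¬ Avoids Z D) :
    historyProb (Φ.killed Z) L j D = 0 := by
  simp only [Avoids, not_forall, not_not] at hD
  obtain ⟨i, h, hZ⟩ := hD
  refine prod_eq_zero (mem_univ i) ?_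
  simp only [episodeProb, killed_trans]
  induction h using Fin.cases with
  | zero => exact mul_eq_zero_of_left (if_pos hZ) _
  | succ h =>
    exact mul_eq_zero_of_right _ (prod_eq_zero (mem_univ h) (by rw [if_pos hZ, mul_zero]))

open Classical in
theorem historyProb_killed {n S A H : ℕ} (Φ : BMDP n S A H) (Z : Finset (Fin n))
    (L : LearningAlgorithm n A H) (j : ℕ) (D : Fin j → Episode n A H) :
    historyProb (Φ.killed Z) L j D = if Avoids Z D then historyProb Φ L j D else 0 := by
  split_ifs with h
  · exact historyProb_killed_of_avoids Φ L h
  · exact historyProb_killed_of_not_avoids Φ L h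

theorem BMDP.IsValid.trans_nonneg {n S A H : ℕ} {Φ : BMDP n S A H} (hΦ : Φ.IsValid) (x : Fin n)
    (a : Fin A) (y : Fin n) : 0 ≤ Φ.trans x a y :=
  mul_nonneg (hΦ.p_nonneg _ _ _) (hΦ.q_nonneg _ _)

theorem BMDP.IsValid.sum_trans {n S A H : ℕ} {Φ : BMDP n S A H} (hΦ : Φ.IsValid) (x : Fin n)
    (a : Fin A) : ∑ y, Φ.trans x a y = 1 := by
  rw [← hΦ.p_sum (Φ.f x) a, ← sum_fiberwise univ Φ.f]
  refine sum_congr rfl fun s _ => ?_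
  calc ∑ y with Φ.f y = s, Φ.trans x a y = ∑ y with Φ.f y = s, Φ.p (Φ.f x) a s * Φ.q s y :=
        sum_congr rfl fun y hy => by simp only [BMDP.trans, (mem_filter.1 hy).2]
    _ = Φ.p (Φ.f x) a s * ∑ y, Φ.q s y := by
        rw [← mul_sum, sum_filter_of_ne fun y _ hy => not_not.1 fun h => hy (hΦ.q_supp s y h)]
    _ = _ := by rw [hΦ.q_sum, mul_one]

theorem one_sub_le_sum_ite {α : Type*} [Fintype α] [DecidableEq α] {g : α → ℝ} {c : ℝ}
    (hg1 : ∑ x, g x = 1) (hgc : ∀ x, g x ≤ c) (Z : Finset α) :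
    1 - #Z * c ≤ ∑ x, if x ∈ Z then 0 else g x := by
  have h1 : ∑ x ∈ Z, g x ≤ #Z * c := by
    simpa using sum_le_sum fun x (_ : x ∈ Z) => hgc x
  have h2 : (∑ x, if x ∈ Z then 0 else g x) = ∑ x, g x - ∑ x ∈ Z, g x := by
    rw [← Finset.sum_filter_add_sum_filter_not univ (· ∈ Z) g, Finset.sum_ite]
    simp
  linarith

/-- When every context is hit with probability at most `c` in each step, whatever the past, the
first `j` episodes avoid `Z` with probability at least `(1 - |Z| c) ^ ((H + 1) j)`. -/
theorem pow_le_sum_historyProb_killed {n S A H : ℕ} {Φ : BMDP n S A H} (hΦ : Φ.IsValid) {c : ℝ}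
    (hμc : ∀ x, Φ.μ x ≤ c) (hKc : ∀ x a y, Φ.trans x a y ≤ c) (Z : Finset (Fin n))
    (hc : #Z * c ≤ 1) (L : LearningAlgorithm n A H) (j : ℕ) :
    ((1 - #Z * c) ^ (H + 1)) ^ j ≤ ∑ D, historyProb (Φ.killed Z) L j D := by
  refine pow_le_sum_historyProb (by linarith) (fun x => ?_) (fun x a y => ?_)
    (one_sub_le_sum_ite hΦ.μ_sum hμc Z) (fun x a => ?_) L j
  · simp only [BMDP.killed]
    split_ifs
    exacts [le_rfl, hΦ.μ_nonneg x]
  · rw [killed_trans]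
    split_ifs
    exacts [le_rfl, hΦ.trans_nonneg x a y]
  · simp only [killed_trans]
    exact one_sub_le_sum_ite (hΦ.sum_trans x a) (hKc x a) Z

/-! ### The misclassification charge of a pair of contexts -/

/-- The contexts of latent state `s` that the estimate `g` misclassifies under the relabelling
`γ`. -/
def wrongIn {n S : ℕ} (g f : Fin n → Fin S) (γ : Equiv.Perm (Fin S)) (s : Fin S) : Finset (Fin n) :=
  {y | f y = s ∧ g y ≠ γ s}

/-- Twice the fraction of misclassified contexts in the latent state of `x`. -/
noncomputable def stateCharge {n S : ℕ} (g f : Fin n → Fin S) (γ : Equiv.Perm (Fin S))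
    (x : Fin n) : ℝ :=
  2 * #(wrongIn g f γ (f x)) / #(fiber f (f x))

/-- The charge of a pair of contexts: whether `x` is misclassified, together with the charges of the
latent states of `x` and `x'`. -/
noncomputable def pairCharge {n S : ℕ} (g f : Fin n → Fin S) (γ : Equiv.Perm (Fin S))
    (x x' : Fin n) : ℝ :=
  (if g x ≠ γ (f x) then 1 else 0) + stateCharge g f γ x + stateCharge g f γ x'

theorem stateCharge_nonneg {n S : ℕ} (g f : Fin n → Fin S) (γ : Equiv.Perm (Fin S)) (x : Fin n) :
    0 ≤ stateCharge g f γ x := by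
  unfold stateCharge; positivity

theorem pairCharge_nonneg {n S : ℕ} (g f : Fin n → Fin S) (γ : Equiv.Perm (Fin S))
    (x x' : Fin n) : 0 ≤ pairCharge g f γ x x' := by
  have h1 := stateCharge_nonneg g f γ x
  have h2 := stateCharge_nonneg g f γ x'
  unfold pairCharge
  split_ifs <;> linarith

theorem card_fiber_comp_perm {n S : ℕ} (f : Fin n → Fin S) (σ : Equiv.Perm (Fin n)) (s : Fin S) :
    #(fiber (f ∘ σ) s) = #(fiber f s) :=
  card_bij (fun x _ => σ x) (by simp [fiber]) (fun _ _ _ _ h => σ.injective h)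
    fun y hy => ⟨σ.symm y, by simpa [fiber] using hy, by simp⟩

/-- If two relabellings disagree on the latent state of `x`, then every context of this state other
than the swapped one is misclassified under one of them. -/
theorem one_le_stateCharge_add {n S : ℕ} {g f : Fin n → Fin S} {x x' : Fin n} (hx : f x ≠ f x')
    {γ γ' : Equiv.Perm (Fin S)} (hm : 2 ≤ #(fiber f (f x))) (hγ : γ (f x) ≠ γ' (f x)) :
    1 ≤ stateCharge g f γ x + stateCharge g (f ∘ Equiv.swap x x') γ' x' := by
  have hsub : (fiber f (f x)).erase x ⊆
      wrongIn g f γ (f x) ∪ wrongIn g (f ∘ Equiv.swap x x') γ' (f x) := by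
    intro y hy
    have hyx : y ≠ x := ne_of_mem_erase hy
    have hfy : f y = f x := by simpa [fiber] using mem_of_mem_erase hy
    have hyx' : y ≠ x' := fun h => hx (by rw [← hfy, h])
    have hsw : Equiv.swap x x' y = y := Equiv.swap_apply_of_ne_of_ne hyx hyx'
    simp only [wrongIn, mem_union, mem_filter, mem_univ, true_and, Function.comp_apply, hsw, hfy]
    by_contra h
    push Not at h
    exact hγ (h.1.symm.trans h.2)
  have hcard := (card_le_card hsub).trans (card_union_le _ _)
  rw [card_erase_of_mem (by simp [fiber])] at hcard
  have hcard' : (#(fiber f (f x)) : ℝ) ≤ 2 * #(wrongIn g f γ (f x)) +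
      2 * #(wrongIn g (f ∘ Equiv.swap x x') γ' (f x)) := by
    exact_mod_cast (by omega : #(fiber f (f x)) ≤ 2 * #(wrongIn g f γ (f x)) +
      2 * #(wrongIn g (f ∘ Equiv.swap x x') γ' (f x)))
  have hpos : (0 : ℝ) < #(fiber f (f x)) := by exact_mod_cast (by omega : 0 < #(fiber f (f x)))
  have hfx : (f ∘ Equiv.swap x x') x' = f x := by simp
  simp only [stateCharge, hfx, card_fiber_comp_perm]
  rw [← add_div, le_div_iff₀ hpos]
  linarith

/-- Swapping two contexts of different latent states: whatever the estimate `g` and the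
relabellings, the pair is charged at least `1` in total before and after the swap. -/
theorem one_le_pairCharge_add {n S : ℕ} (g f : Fin n → Fin S) {x x' : Fin n} (hx : f x ≠ f x')
    (γ γ' : Equiv.Perm (Fin S)) (hm : ∀ s, 2 ≤ #(fiber f s)) :
    1 ≤ pairCharge g f γ x x' + pairCharge g (f ∘ Equiv.swap x x') γ' x x' := by
  have n1 := stateCharge_nonneg g f γ x
  have n2 := stateCharge_nonneg g f γ x'
  have n3 := stateCharge_nonneg g (f ∘ Equiv.swap x x') γ' x
  have n4 := stateCharge_nonneg g (f ∘ Equiv.swap x x') γ' x'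
  have i1 : (0 : ℝ) ≤ if g x ≠ γ (f x) then 1 else 0 := by split_ifs <;> norm_num
  have i2 : (0 : ℝ) ≤ if g x ≠ γ' ((f ∘ Equiv.swap x x') x) then 1 else 0 := by
    split_ifs <;> norm_num
  unfold pairCharge
  by_cases h1 : γ (f x) = γ' (f x)
  · by_cases h2 : γ (f x') = γ' (f x')
    · have h : g x ≠ γ (f x) ∨ g x ≠ γ' ((f ∘ Equiv.swap x x') x) := by
        by_contra h
        push Not at h
        rw [Function.comp_apply, Equiv.swap_apply_left, ← h2] at h
        exact hx (γ.injective (h.1.symm.trans h.2))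
      rcases h with h | h
      · rw [if_pos h]; linarith
      · rw [if_pos h]; linarith
    · have := one_le_stateCharge_add (g := g) hx.symm (hm _) h2
      rw [Equiv.swap_comm] at this
      linarith
  · have := one_le_stateCharge_add (g := g) hx (hm _) h1
    linarith

/-- The total charge of a union of latent states is twice its number of misclassified contexts. -/
theorem sum_stateCharge {n S : ℕ} (g f : Fin n → Fin S) (γ : Equiv.Perm (Fin S))
    (T : Finset (Fin S)) (hm : ∀ s, 0 < #(fiber f s)) :
    ∑ x with f x ∈ T, stateCharge g f γ x = 2 * #{x | f x ∈ T ∧ g x ≠ γ (f x)} := by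
  have hl : ∑ x with f x ∈ T, stateCharge g f γ x = ∑ s ∈ T, 2 * (#(wrongIn g f γ s) : ℝ) := by
    rw [← sum_fiberwise_of_maps_to (g := f) (t := T) (fun x hx => (mem_filter.1 hx).2)]
    refine sum_congr rfl fun s hs => ?_
    have hfib : (univ.filter fun x => f x ∈ T).filter (fun x => f x = s) = fiber f s := by
      ext x; simp only [mem_filter, mem_univ, true_and, fiber]
      exact ⟨fun h => h.2, fun h => ⟨h ▸ hs, h⟩⟩
    have hpos : (0 : ℝ) < #(fiber f s) := by exact_mod_cast hm s
    rw [hfib, sum_congr rfl (g := fun _ => 2 * (#(wrongIn g f γ s) : ℝ) / #(fiber f s)), sum_const,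
      nsmul_eq_mul]
    · field_simp
    · intro x hx
      have : f x = s := by simpa [fiber] using hx
      simp only [stateCharge, this]
  rw [hl, ← mul_sum]
  congr 1
  rw [card_eq_sum_card_fiberwise (f := f) (t := T) fun x hx => (mem_filter.1 hx).2.1]
  push_cast
  refine sum_congr rfl fun s hs => ?_
  congr 2
  ext x
  simp only [wrongIn, mem_filter, mem_univ, true_and]
  constructor
  · rintro ⟨rfl, h⟩; exact ⟨⟨hs, h⟩, rfl⟩
  · rintro ⟨⟨_, h⟩, rfl⟩; exact ⟨rfl, h⟩

theorem sum_pairCharge {n S : ℕ} (g f : Fin n → Fin S) (γ : Equiv.Perm (Fin S))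
    (T : Finset (Fin S)) (hm : ∀ s, 0 < #(fiber f s)) :
    ∑ x with f x ∈ T, ∑ x' with f x' ∈ T, pairCharge g f γ x x' =
      5 * #{x | f x ∈ T} * #{x | f x ∈ T ∧ g x ≠ γ (f x)} := by
  have h1 : ∑ x with f x ∈ T, (if g x ≠ γ (f x) then (1 : ℝ) else 0) =
      #{x | f x ∈ T ∧ g x ≠ γ (f x)} := by
    rw [← sum_filter, sum_const, nsmul_eq_mul, mul_one, filter_filter]
  simp only [pairCharge, sum_add_distrib, sum_const, sum_stateCharge g f γ T hm, nsmul_eq_mul]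
  rw [← mul_sum, ← mul_sum, h1, sum_stateCharge g f γ T hm]
  ring

/-- A relabelling attaining the minimum that defines `misclassCount`. -/
theorem exists_perm_misclassCount {n S : ℕ} (g f : Fin n → Fin S) (T : Finset (Fin S)) :
    ∃ γ : Equiv.Perm (Fin S), misclassCount g f T = #{x : Fin n | f x ∈ T ∧ g x ≠ γ (f x)} := by
  obtain ⟨γ, -, h⟩ := exists_mem_eq_inf' (s := (univ : Finset (Equiv.Perm (Fin S))))
    ⟨1, mem_univ 1⟩ (fun γ => #{x : Fin n | f x ∈ T ∧ g x ≠ γ (f x)})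
  exact ⟨γ, h⟩

/-- Averaging over a class of decoding functions closed under swaps: if the weight `w` of a
decoding function is unchanged by the swap of `x` and `x'` whenever `V x x'` holds, then `10 |X|`
times the weighted number of misclassified contexts dominates the weighted number of pairs with
different latent states that satisfy `V`. The factor `5 |X|` comes from `sum_pairCharge`, the
remaining `2` from symmetrising over the swap. -/
theorem sum_pairs_le_sum_misclassCount {n S : ℕ} (F : Finset (Fin n → Fin S)) (X : Finset (Fin n))
    (T : Finset (Fin S)) (hX : ∀ f ∈ F, ∀ x, f x ∈ T ↔ x ∈ X)
    (hswap : ∀ f ∈ F, ∀ x ∈ X, ∀ x' ∈ X, f ∘ Equiv.swap x x' ∈ F)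
    (hm : ∀ f ∈ F, ∀ s, 2 ≤ #(fiber f s)) (V : Fin n → Fin n → Prop) [∀ x x', Decidable (V x x')]
    (w : (Fin n → Fin S) → ℝ) (hw : ∀ f ∈ F, 0 ≤ w f)
    (hwswap : ∀ f ∈ F, ∀ x ∈ X, ∀ x' ∈ X, V x x' → w (f ∘ Equiv.swap x x') = w f)
    (g : Fin n → Fin S) :
    ∑ x ∈ X, ∑ x' ∈ X, ∑ f ∈ F with f x ≠ f x', (if V x x' then w f else 0) ≤
      10 * #X * ∑ f ∈ F, w f * misclassCount g f T := by
  choose γ hγ using fun f : Fin n → Fin S => exists_perm_misclassCount g f T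
  have hXf : ∀ f ∈ F, (univ.filter fun x => f x ∈ T) = X := fun f hf => by
    ext x; simp [hX f hf x]
  have hpair : ∀ x ∈ X, ∀ x' ∈ X,
      ∑ f ∈ F with f x ≠ f x', (if V x x' then w f else 0) ≤
        2 * ∑ f ∈ F, w f * pairCharge g f (γ f) x x' := by
    intro x hx x' hx'
    have hnn : ∀ f ∈ F, 0 ≤ w f * pairCharge g f (γ f) x x' := fun f hf =>
      mul_nonneg (hw f hf) (pairCharge_nonneg _ _ _ _ _)
    by_cases hV : V x x'
    swap
    · simp only [hV, if_false, sum_const_zero]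
      exact mul_nonneg zero_le_two (sum_nonneg hnn)
    simp only [hV, if_true]
    let G : Finset (Fin n → Fin S) := F.filter fun f => f x ≠ f x'
    -- Precomposition with the swap is an involution of `G` that preserves `w`.
    have hinv : ∑ f ∈ G, w f * pairCharge g f (γ f) x x' =
        ∑ f ∈ G, w f * pairCharge g (f ∘ Equiv.swap x x') (γ (f ∘ Equiv.swap x x')) x x' := by
      have hmem : ∀ f ∈ G, f ∘ Equiv.swap x x' ∈ G := fun f hf => by
        simp only [G, mem_filter] at hf ⊢
        exact ⟨hswap f hf.1 x hx x' hx', by simpa using hf.2.symm⟩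
      have hinvol : ∀ f : Fin n → Fin S, (f ∘ Equiv.swap x x') ∘ Equiv.swap x x' = f := fun f => by
        funext y; simp
      refine sum_nbij' (fun f => f ∘ Equiv.swap x x') (fun f => f ∘ Equiv.swap x x') hmem hmem
        (fun f _ => hinvol f) (fun f _ => hinvol f) fun f hf => ?_
      rw [hinvol, hwswap f (mem_filter.1 hf).1 x hx x' hx' hV]
    calc ∑ f ∈ G, w f ≤ ∑ f ∈ G, (w f * pairCharge g f (γ f) x x' +
          w f * pairCharge g (f ∘ Equiv.swap x x') (γ (f ∘ Equiv.swap x x')) x x') := by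
          refine sum_le_sum fun f hf => ?_
          have hf' := mem_filter.1 hf
          rw [← mul_add]
          exact le_mul_of_one_le_right (hw f hf'.1)
            (one_le_pairCharge_add g f hf'.2 _ _ (hm f hf'.1))
      _ = 2 * ∑ f ∈ G, w f * pairCharge g f (γ f) x x' := by
          rw [sum_add_distrib, ← hinv, two_mul]
      _ ≤ _ := by
          refine mul_le_mul_of_nonneg_left ?_ zero_le_two
          exact sum_le_sum_of_subset_of_nonneg (filter_subset _ _) fun f hf _ => hnn f hf
  calc _ ≤ ∑ x ∈ X, ∑ x' ∈ X, 2 * ∑ f ∈ F, w f * pairCharge g f (γ f) x x' :=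
        sum_le_sum fun x hx => sum_le_sum fun x' hx' => hpair x hx x' hx'
    _ = 2 * ∑ f ∈ F, w f * ∑ x ∈ X, ∑ x' ∈ X, pairCharge g f (γ f) x x' := by
        simp_rw [← mul_sum]
        congr 1
        simp_rw [mul_sum]
        rw [sum_comm (s := F)]
        exact sum_congr rfl fun x _ => sum_comm
    _ = _ := by
        rw [mul_sum, mul_sum]
        refine sum_congr rfl fun f hf => ?_
        have h := sum_pairCharge g f (γ f) T fun s => lt_of_lt_of_le two_pos (hm f hf s)
        rw [← hγ, hXf f hf] at h
        rw [h]
        ring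

/-! ### The class of decoding functions -/

theorem iota_eq_zero_or_one {S : ℕ} (s : Fin S) : iota s = 0 ∨ iota s = 1 := by
  unfold iota; split_ifs <;> simp

theorem mem_half {S : ℕ} {s : Fin S} {i : Fin 2} : s ∈ half S i ↔ iota s = i := by simp [half]

theorem card_fin_lt {m k : ℕ} (h : k ≤ m) : #{x : Fin m | (x : ℕ) < k} = k := by
  rw [Fin.card_filter_val_lt, min_eq_right h]

theorem card_fin_not_lt {m k : ℕ} (h : k ≤ m) : #{x : Fin m | ¬ (x : ℕ) < k} = m - k := by
  have := card_filter_add_card_filter_not (s := (univ : Finset (Fin m))) (fun x => (x : ℕ) < k)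
  rw [card_fin_lt h, card_univ, Fintype.card_fin] at this
  omega

theorem card_half {S : ℕ} (hS : 2 ∣ S) (i : Fin 2) : #(half S i) = S / 2 := by
  have h0 : half S 0 = ({s : Fin S | (s : ℕ) < S / 2} : Finset (Fin S)) := by
    ext s; simp [half, iota]
  have h1 : half S 1 = ({s : Fin S | ¬ (s : ℕ) < S / 2} : Finset (Fin S)) := by
    ext s; simp [half, iota]
  fin_cases i
  · exact h0 ▸ card_fin_lt (Nat.div_le_self S 2)
  · refine (h1 ▸ card_fin_not_lt (Nat.div_le_self S 2)).trans ?_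
    omega

/-- The half of the latent states to which the context `x` belongs under every decoding function of
the class. -/
def contextSide {n : ℕ} (x : Fin n) : Fin 2 := if (x : ℕ) < n / 2 then 0 else 1

/-- The contexts of the given side. -/
def sideContexts (n : ℕ) (i : Fin 2) : Finset (Fin n) := {x | contextSide x = i}

theorem card_sideContexts (n : ℕ) (i : Fin 2) : #(sideContexts n i) = halfContexts n i := by
  have h0 : sideContexts n 0 = ({x : Fin n | (x : ℕ) < n / 2} : Finset (Fin n)) := by
    ext s; simp [sideContexts, contextSide]
  have h1 : sideContexts n 1 = ({x : Fin n | ¬ (x : ℕ) < n / 2} : Finset (Fin n)) := by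
    ext s; simp [sideContexts, contextSide]
  fin_cases i
  · exact h0 ▸ card_fin_lt (Nat.div_le_self n 2)
  · exact h1 ▸ card_fin_not_lt (Nat.div_le_self n 2)

theorem iota_eq_contextSide_iff {n S : ℕ} {f : Fin n → Fin S} :
    (∀ x, f x ∈ half S 0 ↔ (x : ℕ) < n / 2) ↔ ∀ x, iota (f x) = contextSide x := by
  refine forall_congr' fun x => ?_
  rw [mem_half, contextSide]
  rcases iota_eq_zero_or_one (f x) with h | h <;> rw [h] <;> split_ifs with h' <;> simp [h']

theorem mem_decodingClass {n S : ℕ} {sz : Fin 2 → SignType → ℕ} {f : Fin n → Fin S} :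
    f ∈ decodingClass n S sz ↔ (∀ x, iota (f x) = contextSide x) ∧
      (∀ i, ∀ s ∈ half S i, ∃ σ, s ∈ sizeClass f i σ) ∧
      (∀ i σ, #(sizeClass f i σ) = sz i σ) := by
  rw [← iota_eq_contextSide_iff]
  simp [decodingClass]

theorem mem_sizeClass {n S : ℕ} (hS : 2 ∣ S) {f : Fin n → Fin S}
    (hf : ∀ x, iota (f x) = contextSide x) {i : Fin 2} {σ : SignType} {s : Fin S} :
    s ∈ sizeClass f i σ ↔ iota s = i ∧
      (#(fiber f s) : ℤ) = ((halfContexts n i / (S / 2) : ℕ) : ℤ) + (σ : ℤ) := by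
  have h : (univ.filter fun x => f x ∈ half S i) = sideContexts n i := by
    ext x; simp [mem_half, hf, sideContexts]
  rw [sizeClass, mem_filter, h, card_half hS, card_sideContexts, mem_half]

theorem exists_card_fiber_eq {n S : ℕ} (hS : 2 ∣ S) {sz : Fin 2 → SignType → ℕ}
    {f : Fin n → Fin S} (hf : f ∈ decodingClass n S sz) (s : Fin S) :
    ∃ σ : SignType,
      (#(fiber f s) : ℤ) = ((halfContexts n (iota s) / (S / 2) : ℕ) : ℤ) + (σ : ℤ) := by
  rw [mem_decodingClass] at hf
  obtain ⟨σ, hσ⟩ := hf.2.1 (iota s) s (mem_half.2 rfl)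
  exact ⟨σ, ((mem_sizeClass hS hf.1).1 hσ).2⟩

/-- The class of decoding functions is closed under permutations of the contexts that preserve the
two halves. -/
theorem comp_perm_mem_decodingClass {n S : ℕ} (hS : 2 ∣ S) {sz : Fin 2 → SignType → ℕ}
    {f : Fin n → Fin S} (hf : f ∈ decodingClass n S sz) {σ : Equiv.Perm (Fin n)}
    (hσ : ∀ x, contextSide (σ x) = contextSide x) : f ∘ σ ∈ decodingClass n S sz := by
  rw [mem_decodingClass] at hf ⊢
  have h1 : ∀ x, iota ((f ∘ σ) x) = contextSide x := fun x => (hf.1 (σ x)).trans (hσ x)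
  have h2 : ∀ i τ, sizeClass (f ∘ σ) i τ = sizeClass f i τ := fun i τ => by
    ext s; rw [mem_sizeClass hS h1, mem_sizeClass hS hf.1, card_fiber_comp_perm]
  simp only [h2]
  exact ⟨h1, hf.2⟩

theorem contextSide_swap {n : ℕ} {i : Fin 2} {x x' : Fin n} (hx : x ∈ sideContexts n i)
    (hx' : x' ∈ sideContexts n i) (y : Fin n) :
    contextSide (Equiv.swap x x' y) = contextSide y := by
  simp only [sideContexts, mem_filter, mem_univ, true_and] at hx hx'
  rcases eq_or_ne y x with rfl | h
  · rw [Equiv.swap_apply_left, hx, hx']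
  rcases eq_or_ne y x' with rfl | h'
  · rw [Equiv.swap_apply_right, hx, hx']
  rw [Equiv.swap_apply_of_ne_of_ne h h']

theorem signType_cast_bounds (σ : SignType) : (-1 : ℤ) ≤ σ ∧ (σ : ℤ) ≤ 1 := by
  cases σ <;> decide

theorem halfContexts_bounds (n : ℕ) (i : Fin 2) :
    n / 2 ≤ halfContexts n i ∧ 2 * halfContexts n i ≤ n + 1 := by
  unfold halfContexts; split_ifs <;> omega

theorem seven_le_card_fiber {n S : ℕ} (hS : 2 ∣ S) (hSpos : 0 < S) (hn : 8 * S ≤ n)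
    {sz : Fin 2 → SignType → ℕ} {f : Fin n → Fin S} (hf : f ∈ decodingClass n S sz) (s : Fin S) :
    7 ≤ #(fiber f s) := by
  obtain ⟨σ, hσ⟩ := exists_card_fiber_eq hS hf s
  have h1 := (signType_cast_bounds σ).1
  have h2 := (halfContexts_bounds n (iota s)).1
  have h3 : 8 ≤ halfContexts n (iota s) / (S / 2) := by
    rw [Nat.le_div_iff_mul_le (by omega)]
    omega
  omega

theorem le_two_mul_card_fiber {n S : ℕ} (hS : 2 ∣ S) (hSpos : 0 < S) (hn : 8 * S ≤ n)
    {sz : Fin 2 → SignType → ℕ} {f : Fin n → Fin S} (hf : f ∈ decodingClass n S sz) (s : Fin S) :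
    n ≤ 2 * S * #(fiber f s) := by
  obtain ⟨σ, hσ⟩ := exists_card_fiber_eq hS hf s
  have h1 := (signType_cast_bounds σ).1
  have h2 := (halfContexts_bounds n (iota s)).1
  obtain ⟨u, rfl⟩ := hS
  rw [Nat.mul_div_cancel_left u two_pos] at hσ
  have h3 := Nat.lt_mul_div_succ (halfContexts n (iota s)) (by omega : 0 < u)
  have h4 : halfContexts n (iota s) / u + 1 ≤ #(fiber f s) + 2 := by omega
  have h5 := Nat.mul_le_mul_left u h4
  rw [mul_add u #(fiber f s)] at h5
  rw [show 2 * (2 * u) * #(fiber f s) = 4 * (u * #(fiber f s)) by ring]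
  omega

theorem two_mul_card_fiber_le {n S : ℕ} (hS : 2 ∣ S) (hS8 : 8 ≤ S) (hn : 8 * S ≤ n)
    {sz : Fin 2 → SignType → ℕ} {f : Fin n → Fin S} (hf : f ∈ decodingClass n S sz) (s : Fin S) :
    2 * #(fiber f s) ≤ halfContexts n (iota s) := by
  obtain ⟨σ, hσ⟩ := exists_card_fiber_eq hS hf s
  have h1 := (signType_cast_bounds σ).2
  have h2 := (halfContexts_bounds n (iota s)).1
  have h3 := Nat.div_mul_le_self (halfContexts n (iota s)) (S / 2)
  have h4 := Nat.mul_le_mul_left (halfContexts n (iota s) / (S / 2)) (by omega : 4 ≤ S / 2)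
  omega

/-- A map with prescribed fibre cardinalities. -/
theorem exists_card_fiber {α β : Type*} [Fintype α] [Fintype β] [DecidableEq β] (c : β → ℕ)
    (hc : ∑ b, c b = Fintype.card α) : ∃ f : α → β, ∀ b, #{a | f a = b} = c b := by
  have e : α ≃ Σ b, Fin (c b) := Fintype.equivOfCardEq (by simp [hc])
  refine ⟨fun a => (e a).1, fun b => ?_⟩
  rw [← Fintype.card_subtype]
  calc Fintype.card {a // (e a).1 = b} = Fintype.card {p : Σ b, Fin (c b) // p.1 = b} :=
        Fintype.card_congr (e.subtypeEquiv fun _ => Iff.rfl)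
    _ = Fintype.card (Fin (c b)) := Fintype.card_congr (Equiv.sigmaSubtype b)
    _ = c b := Fintype.card_fin _

/-- A version of `exists_card_fiber` for maps over a common base `ι`. -/
theorem exists_card_fiber_over {α β ι : Type*} [Fintype α] [Fintype β] [DecidableEq β]
    [DecidableEq ι] (u : α → ι) (v : β → ι) (c : β → ℕ)
    (hc : ∀ i, ∑ b with v b = i, c b = #{a | u a = i}) :
    ∃ f : α → β, (∀ a, v (f a) = u a) ∧ ∀ b, #{a | f a = b} = c b := by
  have h : ∀ i, ∃ f : {a // u a = i} → {b // v b = i}, ∀ b, #{a | f a = b} = c b := fun i =>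
    exists_card_fiber (fun b : {b // v b = i} => c b) (by
      rw [Fintype.card_subtype, ← hc i]
      exact (sum_subtype _ (by simp) c).symm)
  choose f hf using h
  refine ⟨fun a => f (u a) ⟨a, rfl⟩, fun a => (f (u a) ⟨a, rfl⟩).2, fun b => ?_⟩
  have hfi : ∀ a i (ha : u a = i), ((f (u a) ⟨a, rfl⟩ : {b // v b = u a}) : β) = f i ⟨a, ha⟩ := by
    rintro a _ rfl; rfl
  rw [← hf (v b) ⟨b, rfl⟩]
  refine (card_bij (fun a _ => a.1) ?_ (fun _ _ _ _ => Subtype.ext) ?_).symm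
  · rintro ⟨a, ha⟩ h
    simp only [mem_filter, mem_univ, true_and] at h ⊢
    rw [hfi a _ ha, h]
  · intro a ha
    simp only [mem_filter, mem_univ, true_and] at ha
    have hua : u a = v b := by rw [← ha]; exact (f (u a) ⟨a, rfl⟩).2.symm
    refine ⟨⟨a, hua⟩, ?_, rfl⟩
    simp only [mem_filter, mem_univ, true_and]
    exact Subtype.ext ((hfi a _ hua).symm.trans ha)

/-- First the size corrections are distributed over the latent states, then the contexts of each
side over the latent states of the corresponding half. -/
theorem decodingClass_nonempty {n S : ℕ} (hS : 2 ∣ S) (hSpos : 0 < S) (hn : 8 * S ≤ n)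
    {sz : Fin 2 → SignType → ℕ} (hsz : IsSizeProfile n S sz) : (decodingClass n S sz).Nonempty := by
  have hfst : ∀ (i : Fin 2) (c : Fin 2 × SignType → ℕ),
      ∑ b with b.1 = i, c b = ∑ σ, c (i, σ) := fun i c => by
    rw [sum_filter, Fintype.sum_prod_type, Fin.sum_univ_two]
    fin_cases i <;> simp
  -- `t s` records the half of `s` and the correction `σ` of its size.
  obtain ⟨t, ht1, ht2⟩ := exists_card_fiber_over (iota (S := S)) (Prod.fst (β := SignType))
    (fun b => sz b.1 b.2) fun i => by
      rw [hfst, hsz.total, ← card_half hS i]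
      rfl
  let M : Fin 2 → ℤ := fun i => ((halfContexts n i / (S / 2) : ℕ) : ℤ)
  have hM : ∀ i, 8 ≤ M i := fun i => by
    have h2 := (halfContexts_bounds n i).1
    have h3 : 8 ≤ halfContexts n i / (S / 2) := by
      rw [Nat.le_div_iff_mul_le (by omega)]
      omega
    exact Nat.cast_le (α := ℤ).2 h3
  -- `M i ≥ 1` keeps the truncation harmless when the correction is `-1`.
  let c : Fin S → ℕ := fun s => (M (iota s) + ((t s).2 : ℤ)).toNat
  have hc : ∀ s, (c s : ℤ) = M (iota s) + ((t s).2 : ℤ) := fun s =>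
    Int.toNat_of_nonneg (by
      have := hM (iota s)
      have := (signType_cast_bounds (t s).2).1
      omega)
  have hts : ∀ i σ s, t s = (i, σ) ↔ iota s = i ∧ (t s).2 = σ := fun i σ s => by
    rw [Prod.ext_iff, ht1]
  obtain ⟨f, hf1, hf2⟩ := exists_card_fiber_over (contextSide (n := n)) (iota (S := S)) c
    fun i => by
    have h : ((∑ s with iota s = i, c s : ℕ) : ℤ) = halfContexts n i := by
      rw [← hsz.contexts i, Nat.cast_sum,
        ← sum_fiberwise (univ.filter fun s => iota s = i) (fun s => (t s).2)]
      refine sum_congr rfl fun σ _ => ?_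
      rw [filter_filter, ← ht2 (i, σ)]
      simp only [hts]
      rw [sum_congr rfl (g := fun _ => M i + (σ : ℤ)), sum_const, nsmul_eq_mul]
      intro s hs
      obtain ⟨rfl, rfl⟩ := (mem_filter.1 hs).2
      exact hc s
    have h' : ∑ s with iota s = i, c s = halfContexts n i := by exact_mod_cast h
    rw [h', ← card_sideContexts n i]
    rfl
  have hmem : ∀ i σ s, s ∈ sizeClass f i σ ↔ iota s = i ∧ (t s).2 = σ := by
    intro i σ s
    rw [mem_sizeClass hS hf1]
    refine and_congr_right ?_
    rintro rfl
    rw [show #(fiber f s) = c s from hf2 s, hc s]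
    have hinj : ∀ σ τ : SignType, (σ : ℤ) = τ ↔ σ = τ := by decide
    rw [← hinj]
    exact add_right_inj _
  refine ⟨f, mem_decodingClass.2 ⟨hf1, fun i s hs => ⟨(t s).2, ?_⟩, fun i σ => ?_⟩⟩
  · exact (hmem _ _ _).2 ⟨mem_half.1 hs, rfl⟩
  · rw [← ht2 (i, σ)]
    congr 1
    ext s
    rw [hmem, mem_filter, hts]
    simp

/-! ### The hard instances -/

theorem kappa_le_one {η : ℝ} (hη : 1 < η) {ε : Fin 2 → ℝ}
    (hε : ∀ i, 0 ≤ ε i ∧ ε i < 1 / 2 * ((η - 1) / (η + 1))) : kappa η ε ≤ 1 := by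
  have h0 := (hε 0).1.trans (le_max_left (ε 0) (ε 1))
  have h1 : max (ε 0) (ε 1) < 1 / 2 * ((η - 1) / (η + 1)) := max_lt (hε 0).2 (hε 1).2
  have h2 : (η - 1) / (η + 1) ≤ 1 := (div_le_one (by linarith)).2 (by linarith)
  have h3 : 0 ≤ η * (1 - 2 * max (ε 0) (ε 1)) := mul_nonneg (by linarith) (by linarith)
  exact (div_le_one (by linarith)).2 (by linarith)

theorem hardBMDP_trans_le {n S A H : ℕ} {ε : Fin 2 → ℝ} (hε : ∀ i, 0 ≤ ε i ∧ ε i ≤ 1 / 2)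
    {pt : Fin S → Fin S → ℝ} (hpt0 : ∀ s s', 0 ≤ pt s s') (hpt : ∀ s s', pt s s' ≤ 4 / S)
    {f : Fin n → Fin S} (hfib : ∀ s, n ≤ 2 * S * #(fiber f s)) (astar : Fin S → Fin A)
    (x : Fin n) (a : Fin A) (y : Fin n) : (hardBMDP H ε pt f astar).trans x a y ≤ 8 / n := by
  have hn : (0 : ℝ) < n := by exact_mod_cast x.pos
  have hS : (0 : ℝ) < S := by exact_mod_cast (f x).pos
  have hp : (hardBMDP H ε pt f astar).p (f x) a (f y) ≤ 4 / S := by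
    have e := hε (iota (f x))
    have p0 := hpt0 (f x) (f y)
    have p1 := hpt (f x) (f y)
    simp only [hardBMDP]
    split_ifs
    · linarith
    · nlinarith
    · nlinarith
  have hfy : (n : ℝ) ≤ 2 * S * #(fiber f (f y)) := by exact_mod_cast hfib (f y)
  have hm : (0 : ℝ) < #(fiber f (f y)) := by
    by_contra h
    have : 2 * (S : ℝ) * #(fiber f (f y)) ≤ 0 := mul_nonpos_of_nonneg_of_nonpos (by positivity)
      (not_lt.1 h)
    linarith
  have hq : (hardBMDP H ε pt f astar).q (f y) y = 1 / (#(fiber f (f y)) : ℝ) := if_pos rfl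
  calc (hardBMDP H ε pt f astar).p (f x) a (f y) * (hardBMDP H ε pt f astar).q (f y) y
      ≤ 4 / S * (1 / (#(fiber f (f y)) : ℝ)) := by
        rw [hq]; exact mul_le_mul_of_nonneg_right hp (by positivity)
    _ ≤ 8 / n := by
        rw [div_mul_div_comm, div_le_div_iff₀ (by positivity) hn]
        linarith

/-- Swapping contexts that do not occur in a record leaves its probability unchanged. -/
theorem historyProb_hardBMDP_comp_perm {n S A H : ℕ} (ε : Fin 2 → ℝ) (pt : Fin S → Fin S → ℝ)
    (f : Fin n → Fin S) (astar : Fin S → Fin A) (L : LearningAlgorithm n A H) {j : ℕ}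
    {D : Fin j → Episode n A H} {σ : Equiv.Perm (Fin n)}
    (hσ : ∀ x, iota (f (σ x)) = iota (f x)) (hD : ∀ i h, σ ((D i).ctx h) = (D i).ctx h) :
    historyProb (hardBMDP H ε pt (f ∘ σ) astar) L j D =
      historyProb (hardBMDP H ε pt f astar) L j D := by
  have hr : (hardBMDP H ε pt (f ∘ σ) astar).r = (hardBMDP H ε pt f astar).r := by
    simp only [hardBMDP, Function.comp_apply, hσ]
  have htrans : ∀ x a y, σ x = x → σ y = y → (hardBMDP H ε pt (f ∘ σ) astar).trans x a y =
      (hardBMDP H ε pt f astar).trans x a y := fun x a y hx hy => by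
    simp only [BMDP.trans, hardBMDP, Function.comp_apply, hx, hy, card_fiber_comp_perm]
  refine prod_congr rfl fun i _ => ?_
  rw [hr]
  simp only [episodeProb]
  congr 1
  refine prod_congr rfl fun h _ => ?_
  rw [htrans _ _ _ _ (hD i h.succ)]
  have := hD i h.castSucc
  simpa [Episode.ctx] using this

theorem exp_neg_two_mul_le {t : ℝ} (h0 : 0 ≤ t) (h1 : t ≤ 1 / 2) : Real.exp (-(2 * t)) ≤ 1 - t := by
  have h := Real.add_one_le_exp (2 * t)
  rw [Real.exp_neg, inv_le_comm₀ (Real.exp_pos _) (by linarith)]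
  refine le_trans ?_ h
  rw [inv_le_iff_one_le_mul₀ (by linarith)]
  nlinarith

/-! ### The lower bound -/

/-- If no fibre meeting `X` has more than `|X| / 2` elements, at least half of the pairs in `X × X`
consist of contexts of different latent states. -/
theorem half_le_sum_card_ne {n S : ℕ} {f : Fin n → Fin S} {X : Finset (Fin n)}
    (h : ∀ x ∈ X, 2 * #(fiber f (f x)) ≤ #X) :
    (#X : ℝ) * #X / 2 ≤ ∑ x ∈ X, (#{x' ∈ X | f x ≠ f x'} : ℝ) := by
  have hx : ∀ x ∈ X, (#X : ℝ) / 2 ≤ (#{x' ∈ X | f x ≠ f x'} : ℝ) := fun x hx => by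
    have h1 := card_filter_add_card_filter_not (s := X) (fun x' => f x = f x')
    have h2 : #{x' ∈ X | f x = f x'} ≤ #(fiber f (f x)) :=
      card_le_card fun y hy => by simpa [fiber] using (mem_filter.1 hy).2.symm
    have h3 := h x hx
    have h4 : (#X : ℝ) ≤ 2 * #{x' ∈ X | f x ≠ f x'} := by
      exact_mod_cast (by simp only [ne_eq]; omega : #X ≤ 2 * #{x' ∈ X | f x ≠ f x'})
    linarith
  calc (#X : ℝ) * #X / 2 = ∑ x ∈ X, (#X : ℝ) / 2 := by rw [sum_const, nsmul_eq_mul]; ring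
    _ ≤ _ := sum_le_sum hx

open Classical in
/-- The estimate for one number of contexts, before the survival probability is bounded by an
exponential. -/
theorem pow_mul_card_le_sum_historyExp {n S A H : ℕ} (hS : 2 ∣ S) (hS8 : 8 ≤ S) (hn : 8 * S ≤ n)
    {sz : Fin 2 → SignType → ℕ} {ε : Fin 2 → ℝ} (hε : ∀ i, 0 ≤ ε i ∧ ε i ≤ 1 / 2)
    {pt : Fin S → Fin S → ℝ} (hpt : IsKernelPair pt) (hpt4 : ∀ s s', pt s s' ≤ 4 / S)
    (astar : Fin S → Fin A) (L : LearningAlgorithm n A H) (E : EstimationAlgorithm n S A H)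
    (j : ℕ) :
    (n : ℝ) / 40 * ((1 - 16 / n) ^ (H + 1)) ^ j * #(decodingClass n S sz) ≤
      ∑ f ∈ decodingClass n S sz, historyExp (hardBMDP H ε pt f astar) L j fun D =>
        (misclassCount (E j D (hardBMDP H ε pt f astar).r) f (half S 1) : ℝ) := by
  set F := decodingClass n S sz
  set X := sideContexts n 1
  set B : ℝ := ((1 - 16 / n) ^ (H + 1)) ^ j
  have hn0 : (0 : ℝ) < n := by exact_mod_cast (by omega : 0 < n)
  have hn64 : (16 : ℝ) / n ≤ 1 := by
    rw [div_le_one hn0]; exact_mod_cast (by omega : 16 ≤ n)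
  have hB : 0 ≤ B := pow_nonneg (pow_nonneg (by linarith) _) _
  have hside : ∀ f ∈ F, ∀ x, iota (f x) = contextSide x := fun f hf => (mem_decodingClass.1 hf).1
  have hfib : ∀ f ∈ F, ∀ s, 7 ≤ #(fiber f s) := fun f hf s =>
    seven_le_card_fiber hS (by omega) hn hf s
  have hvalid : ∀ f ∈ F, (hardBMDP H ε pt f astar).IsValid := fun f hf =>
    hardBMDP_isValid H (by omega) hε hpt (fun s => by
      obtain ⟨x, hx⟩ := card_pos.1 (by have := hfib f hf s; omega : 0 < #(fiber f s))
      exact ⟨x, by simpa [fiber] using hx⟩) astar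
  -- The rewards reveal only the side of a context, so the estimate depends on the record alone.
  obtain ⟨R, hR⟩ : ∃ R : Reward n A H, ∀ f ∈ F, (hardBMDP H ε pt f astar).r = R :=
    ⟨fun _ x _ => if contextSide x = 1 then 1 else 0, fun f hf => by
      simp only [hardBMDP, hside f hf]⟩
  let P : (Fin n → Fin S) → (Fin j → Episode n A H) → ℝ := fun f D =>
    historyProb (hardBMDP H ε pt f astar) L j D
  have hrecord : ∀ D : Fin j → Episode n A H,
      ∑ x ∈ X, ∑ x' ∈ X, ∑ f ∈ F with f x ≠ f x', (if Avoids {x, x'} D then P f D else 0) ≤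
        10 * #X * ∑ f ∈ F, P f D * misclassCount (E j D R) f (half S 1) := by
    intro D
    refine sum_pairs_le_sum_misclassCount F X (half S 1) ?_ ?_ ?_ (fun x x' => Avoids {x, x'} D)
      (fun f => P f D) ?_ ?_ (E j D R)
    · intro f hf x
      simp [mem_half, hside f hf, X, sideContexts]
    · exact fun f hf x hx x' hx' => comp_perm_mem_decodingClass hS hf (contextSide_swap hx hx')
    · exact fun f hf s => le_trans (by norm_num) (hfib f hf s)
    · exact fun f hf => historyProb_nonneg (hvalid f hf).μ_nonneg (hvalid f hf).trans_nonneg L j D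
    · intro f hf x hx x' hx' hV
      refine historyProb_hardBMDP_comp_perm ε pt f astar L (fun y => ?_) fun i h => ?_
      · rw [hside f hf, hside f hf, contextSide_swap hx hx']
      · have := hV i h
        simp only [mem_insert, mem_singleton, not_or] at this
        exact Equiv.swap_apply_of_ne_of_ne this.1 this.2
  have hsurv : ∀ f ∈ F, ∀ x x', B ≤ ∑ D, if Avoids {x, x'} D then P f D else 0 := by
    intro f hf x x'
    have hZ : (#({x, x'} : Finset (Fin n)) : ℝ) * (8 / n) ≤ 16 / n := by
      have : (#({x, x'} : Finset (Fin n)) : ℝ) ≤ 2 := by exact_mod_cast card_le_two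
      calc _ ≤ 2 * (8 / (n : ℝ)) := by gcongr
        _ = 16 / n := by ring
    have h := pow_le_sum_historyProb_killed (hvalid f hf) (c := 8 / n) (fun x => ?_)
      (hardBMDP_trans_le hε hpt.nonneg hpt4
        (fun s => le_two_mul_card_fiber hS (by omega) hn hf s) astar) {x, x'} (by linarith) L j
    · simp only [historyProb_killed] at h
      refine le_trans ?_ h
      exact pow_le_pow_left₀ (pow_nonneg (by linarith) _)
        (pow_le_pow_left₀ (by linarith) (by linarith) _) _
    · change 1 / (n : ℝ) ≤ 8 / n
      gcongr
      norm_num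
  have hpairs : B * (#F * (#X * #X / 2)) ≤
      ∑ x ∈ X, ∑ x' ∈ X, ∑ f ∈ F with f x ≠ f x', B := by
    have h1 : ∑ x ∈ X, ∑ x' ∈ X, ∑ f ∈ F with f x ≠ f x', B =
        B * ∑ f ∈ F, ∑ x ∈ X, (#{x' ∈ X | f x ≠ f x'} : ℝ) := by
      calc _ = ∑ x ∈ X, ∑ x' ∈ X, ∑ f ∈ F, if f x ≠ f x' then B else 0 := by
            simp only [sum_filter]
        _ = ∑ f ∈ F, ∑ x ∈ X, ∑ x' ∈ X, if f x ≠ f x' then B else 0 :=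
            (sum_comm.trans (sum_congr rfl fun x _ => sum_comm)).symm
        _ = _ := by
            simp only [← sum_filter, sum_const, nsmul_eq_mul, mul_sum]
            exact sum_congr rfl fun f _ => sum_congr rfl fun x _ => mul_comm _ _
    rw [h1]
    refine mul_le_mul_of_nonneg_left ?_ hB
    rw [← nsmul_eq_mul, ← sum_const]
    refine sum_le_sum fun f hf => half_le_sum_card_ne fun x hx => ?_
    have h := two_mul_card_fiber_le hS hS8 hn hf (f x)
    rwa [hside f hf, (mem_filter.1 hx).2, ← card_sideContexts] at h
  have htotal : B * (#F * (#X * #X / 2)) ≤ 10 * #X *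
      ∑ f ∈ F, ∑ D, P f D * misclassCount (E j D R) f (half S 1) := by
    calc _ ≤ _ := hpairs
      _ ≤ ∑ x ∈ X, ∑ x' ∈ X, ∑ f ∈ F with f x ≠ f x',
            ∑ D, if Avoids {x, x'} D then P f D else 0 :=
          sum_le_sum fun x _ => sum_le_sum fun x' _ => sum_le_sum fun f hf =>
            hsurv f (mem_filter.1 hf).1 x x'
      _ = ∑ D, ∑ x ∈ X, ∑ x' ∈ X, ∑ f ∈ F with f x ≠ f x',
            (if Avoids {x, x'} D then P f D else 0) :=
          (sum_comm.trans (sum_congr rfl fun x _ =>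
            sum_comm.trans (sum_congr rfl fun x' _ => sum_comm))).symm
      _ ≤ _ := sum_le_sum fun D _ => hrecord D
      _ = _ := by rw [← mul_sum, sum_comm]
  have hexp : ∑ f ∈ F, historyExp (hardBMDP H ε pt f astar) L j (fun D =>
      (misclassCount (E j D (hardBMDP H ε pt f astar).r) f (half S 1) : ℝ)) =
        ∑ f ∈ F, ∑ D, P f D * misclassCount (E j D R) f (half S 1) :=
    sum_congr rfl fun f hf => by simp only [historyExp, hR f hf, P]
  rw [hexp]
  have hX2 : (n : ℝ) ≤ 2 * #X := by
    have : #X = n - n / 2 := card_sideContexts n 1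
    exact_mod_cast (by omega : n ≤ 2 * #X)
  have hXpos : (0 : ℝ) < #X := by linarith
  have hcancel : B * #F * (#X / 2) ≤
      10 * ∑ f ∈ F, ∑ D, P f D * misclassCount (E j D R) f (half S 1) := by
    refine le_of_mul_le_mul_left ?_ hXpos
    linarith
  have hBF : 0 ≤ B * #F := by positivity
  nlinarith

theorem mainTheorem3 (η : ℝ) (hη : 1 < η) :
    ∃ C : ℝ, 0 < C ∧
      ∀ S : ℕ → ℕ,
        (fun n => (S n : ℝ)) =o[atTop] (fun n => (n : ℝ)) →
        (∀ n, 4 ∣ S n ∧ 2 ≤ S n / 4) →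
        ∀ᶠ n : ℕ in atTop,
          ∀ A H : ℕ, S n / 2 ≤ A → 2 ≤ H →
          ∀ sz : Fin 2 → SignType → ℕ, IsSizeProfile n (S n) sz →
          ∀ ε : Fin 2 → ℝ, (∀ i, 0 ≤ ε i ∧ ε i < 1 / 2 * ((η - 1) / (η + 1))) →
          ∀ pt : Fin (S n) → Fin (S n) → ℝ, IsKernelPair pt →
            (∀ s s', |pt s s' - 2 / (S n : ℝ)| ≤ 2 * kappa η ε / (S n : ℝ)) →
          ∀ astar : Fin (S n) → Fin A, Set.InjOn astar (half (S n) 1) →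
          ∀ (L : LearningAlgorithm n A H) (E : EstimationAlgorithm n (S n) A H) (k : ℕ), 1 ≤ k →
            (n : ℝ) / 144 * Real.exp (-(C * (((k * H : ℕ) : ℝ) / (n : ℝ)))) ≤
              1 / (#(decodingClass n (S n) sz) : ℝ) *
                ∑ f ∈ decodingClass n (S n) sz,
                  historyExp (hardBMDP H ε pt f astar) L (k - 1) (fun D =>
                    (misclassCount (E (k - 1) D (hardBMDP H ε pt f astar).r) f
                      (half (S n) 1) : ℝ)) := by
  -- `64 = 2 · 2 · 16`: a step hits a given pair of contexts with probability at most `16 / n`,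
  -- `1 - t ≥ exp (-2 t)`, and an episode has `H + 1 ≤ 2 H` contexts.
  refine ⟨64, by norm_num, fun S hSo hS => ?_⟩
  filter_upwards [hSo.def (by norm_num : (0 : ℝ) < 1 / 8)] with n hn
  intro A H _ hH sz hsz ε hε pt hpt hptκ astar _ L E k hk
  have hS8 : 8 ≤ S n := by have := hS n; omega
  have hS2 : 2 ∣ S n := by have := hS n; omega
  have hn8 : 8 * S n ≤ n := by
    simp only [Real.norm_natCast] at hn
    exact_mod_cast (by linarith : (8 : ℝ) * S n ≤ n)
  have hn0 : (0 : ℝ) < n := by exact_mod_cast (by omega : 0 < n)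
  have hS0 : (0 : ℝ) < S n := by exact_mod_cast (by omega : 0 < S n)
  have hε2 : ∀ i, 0 ≤ ε i ∧ ε i ≤ 1 / 2 := fun i => ⟨(hε i).1, by
    have h1 := (hε i).2
    have h2 : (η - 1) / (η + 1) ≤ 1 := (div_le_one (by linarith)).2 (by linarith)
    linarith⟩
  have hpt4 : ∀ s s', pt s s' ≤ 4 / (S n : ℝ) := fun s s' => by
    have h1 := (abs_le.1 (hptκ s s')).2
    have h2 : 2 * kappa η ε / (S n : ℝ) ≤ 2 / S n := by
      gcongr
      linarith [kappa_le_one hη hε]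
    have h3 : (4 : ℝ) / S n = 2 / S n + 2 / S n := by ring
    linarith
  have hF : (0 : ℝ) < #(decodingClass n (S n) sz) := by
    exact_mod_cast card_pos.2 (decodingClass_nonempty hS2 (by omega) hn8 hsz)
  have key := pow_mul_card_le_sum_historyExp (sz := sz) hS2 hS8 hn8 hε2 hpt hpt4 astar L E (k - 1)
  have hexp : Real.exp (-(64 * (((k * H : ℕ) : ℝ) / (n : ℝ)))) ≤
      ((1 - 16 / (n : ℝ)) ^ (H + 1)) ^ (k - 1) := by
    have ht : (16 : ℝ) / n ≤ 1 / 2 := by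
      rw [div_le_iff₀ hn0]
      have : (32 : ℝ) ≤ n := by exact_mod_cast (by omega : 32 ≤ n)
      linarith
    have hsteps : (((H + 1) * (k - 1) : ℕ) : ℝ) ≤ 2 * ((k * H : ℕ) : ℝ) := by
      have : (H + 1) * (k - 1) ≤ 2 * (k * H) :=
        (Nat.mul_le_mul (by omega : H + 1 ≤ 2 * H) (Nat.sub_le k 1)).trans_eq (by ring)
      exact_mod_cast this
    rw [← pow_mul]
    calc Real.exp (-(64 * (((k * H : ℕ) : ℝ) / (n : ℝ))))
        ≤ Real.exp (((H + 1) * (k - 1) : ℕ) * -(2 * (16 / (n : ℝ)))) := by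
          rw [Real.exp_le_exp]
          have h : (((H + 1) * (k - 1) : ℕ) : ℝ) * (32 / n) ≤ 2 * ((k * H : ℕ) : ℝ) * (32 / n) :=
            mul_le_mul_of_nonneg_right hsteps (by positivity)
          have e1 : (((H + 1) * (k - 1) : ℕ) : ℝ) * -(2 * (16 / (n : ℝ))) =
            -((((H + 1) * (k - 1) : ℕ) : ℝ) * (32 / n)) := by ring
          have e2 : 64 * (((k * H : ℕ) : ℝ) / (n : ℝ)) = 2 * ((k * H : ℕ) : ℝ) * (32 / n) := by
            ring
          rw [e1, e2]
          exact neg_le_neg h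
      _ = Real.exp (-(2 * (16 / (n : ℝ)))) ^ ((H + 1) * (k - 1)) := by
          rw [← Real.exp_nat_mul]
      _ ≤ _ := by
          gcongr
          exact exp_neg_two_mul_le (by positivity) ht
  rw [one_div, ← div_eq_inv_mul, le_div_iff₀ hF]
  refine le_trans (mul_le_mul_of_nonneg_right ?_ hF.le) key
  gcongr
  norm_num
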